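/- Theorem. Let $T>0$, let $U=1+H^1_0(0,T)$, and let $a,b:\mathbb R\to\mathbb R$ be globally Lipschitz continuous, with $b$ differentiable everywhere on $\mathbb R$ and $a\ge a_0$ for some constant $a_0>0$. For $u\in U$ put $$F(u)=\int_0^T\bigl[a(u)\,u'^2+b(u)\bigr]\,dx,\qquad (Bu)(x)=\int_x^{x+1}u(s)\,ds\quad(x\in[0,T-1]),$$ and let $K=\{u\in U: (Bu)(x)\ge 0\text{ for all }x\in[0,T-1]\}$ (for $T<1$ the interval $[0,T-1]$ is empty and there is no constraint). Let $u\in K$ be a minimizer of $F$ over $K$, and let $\omega_c=\{x\in[0,T-1]:(Bu)(x)=0\}$ be its contact set. Then $u\in W^{2,\infty}(0,T)$, and there exists a finite nonnegative Radon measure $f$ on $[0,T-1]$, extended by zero to $\mathbb R$, with $\operatorname{supp} f\subset\omega_c$, such that for almost every $x\in(0,T)$ $$-2a(u(x))\,u''(x)-a'(u(x))\,u'(x)^2+b'(u(x))=f([x-1,x]).$$ Here $u',u''$ are weak derivatives, and $a'(u)\,u'^2$ is taken to be $0$ at points $x$ where $a$ is not differentiable at $u(x)$ (for almost every such $x$ one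 has $u'(x)=0$). -/

import Mathlib

open MeasureTheory
open scoped ENNReal NNReal ContDiff

noncomputable section

/-- Lebesgue measure on the interval `(0,T)`. Elements of Sobolev spaces on `(0,T)` are represented
by functions `ℝ → ℝ`, of which only the values almost everywhere on `(0,T)` matter. -/
def intervalMeasure (T : ℝ) : Measure ℝ := volume.restrict (Set.Ioo 0 T)

/-- Smooth functions with compact support in `(0,T)`. -/
def IsTestFunction (T : ℝ) (φ : ℝ → ℝ) : Prop :=
  ContDiff ℝ ∞ φ ∧ HasCompactSupport φ ∧ tsupport φ ⊆ Set.Ioo 0 T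

/-- `w` is a weak derivative of `u` on `(0,T)`. -/
def HasWeakDeriv (T : ℝ) (u w : ℝ → ℝ) : Prop :=
  LocallyIntegrableOn u (Set.Ioo 0 T) ∧ LocallyIntegrableOn w (Set.Ioo 0 T) ∧
    ∀ φ : ℝ → ℝ, IsTestFunction T φ →
      ∫ x in Set.Ioo 0 T, u x * deriv φ x = -∫ x in Set.Ioo 0 T, w x * φ x

open Classical in
/-- The weak derivative of `u` on `(0,T)`; it is unique up to equality almost everywhere on `(0,T)`
when it exists, and set to zero when it does not. -/
def weakDeriv (T : ℝ) (u : ℝ → ℝ) : ℝ → ℝ :=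
  if h : ∃ w, HasWeakDeriv T u w then h.choose else 0

/-- `MemSobolev T p k u` : `u` belongs to `W^{k,p}(0,T)`. -/
def MemSobolev (T : ℝ) (p : ℝ≥0∞) : ℕ → (ℝ → ℝ) → Prop
  | 0, u => MemLp u p (intervalMeasure T)
  | k + 1, u => MemLp u p (intervalMeasure T) ∧ ∃ w, HasWeakDeriv T u w ∧ MemSobolev T p k w

/-- `H^1_0(0,T)` : the closure of the test functions in `H^1(0,T) = W^{1,2}(0,T)`. -/
def MemH10 (T : ℝ) (v : ℝ → ℝ) : Prop :=
  MemSobolev T 2 1 v ∧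
    ∀ ε : ℝ≥0∞, 0 < ε → ∃ φ : ℝ → ℝ, IsTestFunction T φ ∧
      eLpNorm (fun x => v x - φ x) 2 (intervalMeasure T) < ε ∧
      eLpNorm (fun x => weakDeriv T v x - deriv φ x) 2 (intervalMeasure T) < ε

/-- The affine space `U = 1 + H^1_0(0,T)`. -/
def spaceU (T : ℝ) : Set (ℝ → ℝ) := {u | MemH10 T (fun x => u x - 1)}

/-- The energy `F(u) = ∫_0^T [a(u) u'^2 + b(u)]`. -/
def energyF (T : ℝ) (a b : ℝ → ℝ) (u : ℝ → ℝ) : ℝ :=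
  ∫ x in Set.Ioo 0 T, (a (u x) * (weakDeriv T u x) ^ 2 + b (u x))

/-- The constraint operator `(Bu)(x) = ∫_x^{x+1} u`. -/
def opB (u : ℝ → ℝ) (x : ℝ) : ℝ := ∫ s in x..(x + 1), u s

/-- The admissible set `K = {u ∈ U : Bu ≥ 0 on [0,T-1]}`. -/
def admissibleK (T : ℝ) : Set (ℝ → ℝ) :=
  {u | u ∈ spaceU T ∧ ∀ x ∈ Set.Icc 0 (T - 1), 0 ≤ opB u x}

/-- `u` solves Problem (A): it minimizes `F` over `K`. -/
def IsSolutionA (T : ℝ) (a b : ℝ → ℝ) (u : ℝ → ℝ) : Prop :=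
  u ∈ admissibleK T ∧ ∀ v ∈ admissibleK T, energyF T a b u ≤ energyF T a b v

/-- The contact set `ω_c = {x ∈ [0,T-1] : ∫_x^{x+1} u = 0}`. -/
def contactSet (T : ℝ) (u : ℝ → ℝ) : Set ℝ := {x ∈ Set.Icc 0 (T - 1) | opB u x = 0}

end

section

open Filter Set
open scoped Topology

/-! The measure `f` is a Lagrange multiplier for `Bu ≥ 0`, and the regularity of `u` is then read
off from the Euler–Lagrange equation.

First variation. The energy is differentiable along test functions although `a` is only Lipschitz:
the set where `a` is not differentiable is null, so `u' = 0` at almost every point that `u` maps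
into it (`ae_eq_zero_of_hasDerivAt_of_mem_null`). There the term `a(u) u'^2` has zero derivative
anyway (`hasDerivAt_mul_sq`). Since `K` is convex, the variation `L φ` is nonnegative whenever `Bu +
Bφ ≥ 0`.

Multiplier. On the span of `Bu` and all `Bφ` in `C([0,T-1])`, the map `Bφ + s Bu ↦ L φ` is well
defined and positive. A test function with `Bφ ≥ c > 0` lets the M. Riesz theorem extend it to a
positive functional, which Riesz–Markov–Kakutani represents by a measure
(`exists_multiplier_measure`). Evaluating at `Bu` gives `∫ Bu df = 0`, so `f` lives on the contact
set. Fubini turns `∫ Bφ df` into `∫ f([s-1,s]) φ(s) ds` (`integral_opB`). For `T < 1` the space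
`C(∅)` is trivial and the same argument applies.

Regularity. Weakly, `(2a(u)u')' = a'(u)u'^2 + b'(u) - f([x-1,x])`. The right side is in `L^1`, so
the flux `2a(u)u'` is bounded, and `a ≥ a₀ > 0` makes `u'` bounded. Now the right side is bounded,
so the flux is Lipschitz, and so is its quotient `u'` by `2a(u)`. -/

/-! ### Test functions and weak derivatives -/

theorem IsTestFunction.deriv {T : ℝ} {φ : ℝ → ℝ} (h : IsTestFunction T φ) :
    IsTestFunction T (deriv φ) :=
  ⟨h.1.deriv', h.2.1.deriv, tsupport_deriv_subset.trans h.2.2⟩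

theorem IsTestFunction.add {T : ℝ} {φ ψ : ℝ → ℝ} (h : IsTestFunction T φ)
    (h' : IsTestFunction T ψ) : IsTestFunction T (φ + ψ) :=
  ⟨h.1.add h'.1, h.2.1.add h'.2.1,
    (tsupport_add φ ψ).trans (union_subset h.2.2 h'.2.2)⟩

theorem IsTestFunction.smul {T : ℝ} {φ : ℝ → ℝ} (h : IsTestFunction T φ) (c : ℝ) :
    IsTestFunction T (c • φ) :=
  ⟨h.1.const_smul c, h.2.1.smul_left (f := fun _ => c),
    (tsupport_smul_subset_right (fun _ => c) φ).trans h.2.2⟩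

theorem IsTestFunction.zero (T : ℝ) : IsTestFunction T 0 :=
  ⟨contDiff_const, HasCompactSupport.zero, by simp [tsupport]⟩

theorem IsTestFunction.eq_zero {T : ℝ} {φ : ℝ → ℝ} (h : IsTestFunction T φ) {x : ℝ}
    (hx : x ∉ Ioo 0 T) : φ x = 0 :=
  image_eq_zero_of_notMem_tsupport fun h' => hx (h.2.2 h')

theorem IsTestFunction.differentiable {T : ℝ} {φ : ℝ → ℝ} (h : IsTestFunction T φ) :
    Differentiable ℝ φ := h.1.differentiable (by simp)

theorem IsTestFunction.continuous {T : ℝ} {φ : ℝ → ℝ} (h : IsTestFunction T φ) :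
    Continuous φ := h.1.continuous

theorem IsTestFunction.exists_bound {T : ℝ} {φ : ℝ → ℝ} (h : IsTestFunction T φ) :
    ∃ C, 0 ≤ C ∧ ∀ x, |φ x| ≤ C := by
  obtain ⟨C, hC⟩ := h.2.1.exists_bound_of_continuous h.continuous
  exact ⟨C, (norm_nonneg _).trans (hC 0), hC⟩

theorem IsTestFunction.memLp {T : ℝ} {φ : ℝ → ℝ} (h : IsTestFunction T φ) (p : ℝ≥0∞) :
    MemLp φ p (intervalMeasure T) :=
  (h.continuous.memLp_of_hasCompactSupport h.2.1).restrict _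

theorem IsTestFunction.integrable_mul {T : ℝ} {φ g : ℝ → ℝ} (h : IsTestFunction T φ)
    (hg : LocallyIntegrableOn g (Ioo 0 T)) : IntegrableOn (fun x => g x * φ x) (Ioo 0 T) := by
  have h1 : IntegrableOn g (tsupport φ) := hg.integrableOn_compact_subset h.2.2 h.2.1
  obtain ⟨C, hC0, hC⟩ := h.exists_bound
  have h2 : IntegrableOn (fun x => g x * φ x) (tsupport φ) :=
    h1.mul_bdd (c := C) h.continuous.aestronglyMeasurable (Eventually.of_forall hC)
  refine (IntegrableOn.of_forall_sdiff_eq_zero (s := tsupport φ) h2 measurableSet_Ioo ?_)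
  intro x hx
  simp [image_eq_zero_of_notMem_tsupport hx.2]

/-- Uniqueness in the fundamental lemma of the calculus of variations on `(0,T)`. -/
theorem ae_eq_of_forall_integral_mul_test {T : ℝ} {g h : ℝ → ℝ}
    (hg : LocallyIntegrableOn g (Ioo 0 T)) (hh : LocallyIntegrableOn h (Ioo 0 T))
    (H : ∀ φ, IsTestFunction T φ →
      ∫ x in Ioo 0 T, g x * φ x = ∫ x in Ioo 0 T, h x * φ x) :
    g =ᵐ[volume.restrict (Ioo 0 T)] h := by
  have := isOpen_Ioo.ae_eq_zero_of_integral_contDiff_smul_eq_zero (μ := volume)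
    (U := Ioo 0 T) (f := fun x => g x - h x) (hg.sub hh) (fun φ h1 h2 h3 => by
      have hφ : IsTestFunction T φ := ⟨h1, h2, h3⟩
      have e : ∫ x, φ x • (g x - h x) = ∫ x in Ioo 0 T, (g x * φ x - h x * φ x) := by
        rw [setIntegral_eq_integral_of_forall_compl_eq_zero]
        · congr 1; ext x; simp; ring
        · intro x hx; simp [hφ.eq_zero hx]
      rw [e, integral_sub (hφ.integrable_mul hg) (hφ.integrable_mul hh), H φ hφ, sub_self])
  rw [EventuallyEq, ae_restrict_iff' measurableSet_Ioo]
  filter_upwards [this] with x hx hxT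
  have := hx hxT
  linarith

theorem HasWeakDeriv.unique {T : ℝ} {u w w' : ℝ → ℝ} (h : HasWeakDeriv T u w)
    (h' : HasWeakDeriv T u w') : w =ᵐ[volume.restrict (Ioo 0 T)] w' :=
  ae_eq_of_forall_integral_mul_test h.2.1 h'.2.1 fun φ hφ => by
    have := h.2.2 φ hφ
    have := h'.2.2 φ hφ
    linarith

theorem MeasureTheory.LocallyIntegrableOn.congr_ae_restrict {s : Set ℝ} {u v : ℝ → ℝ}
    (hu : LocallyIntegrableOn u s) (h : u =ᵐ[volume.restrict s] v) :
    LocallyIntegrableOn v s := by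
  intro x hx
  obtain ⟨t, ht, hut⟩ := hu x hx
  obtain ⟨o, ho, hxo, hos⟩ := mem_nhdsWithin.1 ht
  refine ⟨o ∩ s, mem_nhdsWithin.2 ⟨o, ho, hxo, Subset.rfl⟩, ?_⟩
  exact (hut.mono_set hos).congr_fun_ae (ae_restrict_of_ae_restrict_of_subset inter_subset_right h)

theorem HasWeakDeriv.congr_ae {T : ℝ} {u v w z : ℝ → ℝ} (h : HasWeakDeriv T u w)
    (hv : u =ᵐ[volume.restrict (Ioo 0 T)] v) (hz : w =ᵐ[volume.restrict (Ioo 0 T)] z) :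
    HasWeakDeriv T v z := by
  refine ⟨h.1.congr_ae_restrict hv, h.2.1.congr_ae_restrict hz, fun φ hφ => ?_⟩
  have h1 : ∫ x in Ioo 0 T, v x * _root_.deriv φ x = ∫ x in Ioo 0 T, u x * _root_.deriv φ x :=
    integral_congr_ae (hv.mono fun x hx => by simp [hx])
  have h2 : ∫ x in Ioo 0 T, z x * φ x = ∫ x in Ioo 0 T, w x * φ x :=
    integral_congr_ae (hz.mono fun x hx => by simp [hx])
  rw [h1, h2, h.2.2 φ hφ]

theorem HasWeakDeriv.hasWeakDeriv_weakDeriv {T : ℝ} {u w : ℝ → ℝ} (h : HasWeakDeriv T u w) :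
    HasWeakDeriv T u (weakDeriv T u) := by
  have : ∃ w, HasWeakDeriv T u w := ⟨w, h⟩
  rw [weakDeriv, dif_pos this]
  exact this.choose_spec

theorem HasWeakDeriv.weakDeriv_ae_eq {T : ℝ} {u w : ℝ → ℝ} (h : HasWeakDeriv T u w) :
    weakDeriv T u =ᵐ[volume.restrict (Ioo 0 T)] w :=
  h.hasWeakDeriv_weakDeriv.unique h

theorem HasWeakDeriv.add {T : ℝ} {u v w z : ℝ → ℝ} (h : HasWeakDeriv T u w)
    (h' : HasWeakDeriv T v z) :
    HasWeakDeriv T (fun x => u x + v x) (fun x => w x + z x) := by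
  refine ⟨h.1.add h'.1, h.2.1.add h'.2.1, fun φ hφ => ?_⟩
  simp only [add_mul]
  rw [integral_add (hφ.deriv.integrable_mul h.1) (hφ.deriv.integrable_mul h'.1),
    integral_add (hφ.integrable_mul h.2.1) (hφ.integrable_mul h'.2.1), h.2.2 φ hφ, h'.2.2 φ hφ]
  ring

theorem HasWeakDeriv.const_mul {T : ℝ} {u w : ℝ → ℝ} (h : HasWeakDeriv T u w) (c : ℝ) :
    HasWeakDeriv T (fun x => c * u x) (fun x => c * w x) := by
  refine ⟨h.1.smul c, h.2.1.smul c, fun φ hφ => ?_⟩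
  simp only [mul_assoc, integral_const_mul]
  rw [h.2.2 φ hφ]
  ring

/-- An absolutely continuous function is weakly differentiable, with its pointwise derivative. -/
theorem AbsolutelyContinuousOnInterval.hasWeakDeriv {T : ℝ} (hT : 0 < T) {f w : ℝ → ℝ}
    (hf : AbsolutelyContinuousOnInterval f 0 T)
    (hw : deriv f =ᵐ[volume.restrict (Ioo 0 T)] w) : HasWeakDeriv T f w := by
  have hs : Ioo 0 T ⊆ uIcc 0 T := by rw [uIcc_of_le hT.le]; exact Ioo_subset_Icc_self
  have base : HasWeakDeriv T f (deriv f) := by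
    refine ⟨(hf.continuousOn.mono hs).locallyIntegrableOn measurableSet_Ioo, ?_, fun φ hφ => ?_⟩
    · have := hf.intervalIntegrable_deriv
      rw [intervalIntegrable_iff_integrableOn_Ioo_of_le hT.le] at this
      exact this.locallyIntegrableOn
    · have h1 : AbsolutelyContinuousOnInterval φ 0 T :=
        ContDiffOn.absolutelyContinuousOnInterval (hφ.1.of_le (by simp)).contDiffOn
      have := hf.integral_mul_deriv_eq_deriv_mul h1
      rw [hφ.eq_zero (x := 0) (by simp), hφ.eq_zero (x := T) (by simp),
        intervalIntegral.integral_of_le hT.le, intervalIntegral.integral_of_le hT.le,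
        integral_Ioc_eq_integral_Ioo, integral_Ioc_eq_integral_Ioo] at this
      rw [this]; ring
  exact base.congr_ae (ae_eq_refl _) hw

theorem LipschitzWith.hasWeakDeriv {T : ℝ} (hT : 0 < T) {f : ℝ → ℝ} {C : ℝ≥0}
    (hf : LipschitzWith C f) : HasWeakDeriv T f (deriv f) :=
  AbsolutelyContinuousOnInterval.hasWeakDeriv hT
    hf.lipschitzOnWith.absolutelyContinuousOnInterval (ae_eq_refl _)

theorem IsTestFunction.hasWeakDeriv {T : ℝ} (hT : 0 < T) {φ : ℝ → ℝ} (h : IsTestFunction T φ) :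
    HasWeakDeriv T φ (_root_.deriv φ) :=
  AbsolutelyContinuousOnInterval.hasWeakDeriv hT
    (ContDiffOn.absolutelyContinuousOnInterval (h.1.of_le (by simp)).contDiffOn) (ae_eq_refl _)

theorem hasWeakDeriv_const {T : ℝ} (hT : 0 < T) (c : ℝ) :
    HasWeakDeriv T (fun _ => c) (fun _ => 0) := by
  simpa using LipschitzWith.hasWeakDeriv hT (LipschitzWith.const c)

/-- A primitive of a locally integrable function is weakly differentiable. -/
theorem hasWeakDeriv_primitive {T : ℝ} (hT : 0 < T) {w : ℝ → ℝ} (hw : Integrable w) :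
    HasWeakDeriv T (fun x => ∫ t in (0 : ℝ)..x, w t) w := by
  refine AbsolutelyContinuousOnInterval.hasWeakDeriv hT
    (hw.intervalIntegrable.absolutelyContinuousOnInterval_intervalIntegral (by simp)) ?_
  refine ae_restrict_of_ae ?_
  filter_upwards [LocallyIntegrable.ae_hasDerivAt_integral hw.locallyIntegrable] with x hx
  exact (hx 0).deriv

/-! ### The du Bois-Reymond lemma and absolutely continuous representatives -/

/-- A nonnegative test function equal to `1` on all but a small part of `(0,T)`. -/
theorem exists_test_eq_one {T δ : ℝ} (hδ : 0 < δ) (hδT : 2 * δ < T) :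
    ∃ φ, IsTestFunction T φ ∧ (∀ x, 0 ≤ φ x) ∧ (∀ x ∈ Icc δ (T - δ), φ x = 1) := by
  let B : ContDiffBump (T / 2) := ⟨T / 2 - δ, T / 2 - δ / 2, by linarith, by linarith⟩
  refine ⟨B, ⟨B.contDiff, B.hasCompactSupport, ?_⟩, fun x => B.nonneg, fun x hx => ?_⟩
  · rw [B.tsupport_eq]
    intro x hx
    rw [Real.closedBall_eq_Icc] at hx
    simp only [B, mem_Icc, mem_Ioo] at hx ⊢
    constructor <;> linarith [hx.1, hx.2]
  · apply B.one_of_mem_closedBall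
    rw [Real.closedBall_eq_Icc]
    simp only [B, mem_Icc] at hx ⊢
    constructor <;> linarith [hx.1, hx.2]

/-- A test function of integral zero is the derivative of a test function. -/
theorem IsTestFunction.exists_primitive {T : ℝ} (hT : 0 < T) {φ : ℝ → ℝ}
    (h : IsTestFunction T φ) (h0 : ∫ x in Ioo 0 T, φ x = 0) :
    ∃ Φ, IsTestFunction T Φ ∧ _root_.deriv Φ = φ := by
  set Φ : ℝ → ℝ := fun x => ∫ t in (0 : ℝ)..x, φ t with hΦ
  have hd : ∀ x, HasDerivAt Φ (φ x) x := fun x => h.continuous.integral_hasStrictDerivAt 0 x |>.hasDerivAt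
  have hderiv : _root_.deriv Φ = φ := funext fun x => (hd x).deriv
  obtain ⟨c, d, hc, hd', hcd, hsub⟩ : ∃ c d, 0 < c ∧ d < T ∧ c ≤ d ∧ tsupport φ ⊆ Icc c d := by
    rcases (tsupport φ).eq_empty_or_nonempty with he | hne
    · exact ⟨T / 2, T / 2, by linarith, by linarith, le_rfl, by simp [he]⟩
    · have hK : IsCompact (tsupport φ) := h.2.1
      have h1 := h.2.2 (hK.sInf_mem hne)
      have h2 := h.2.2 (hK.sSup_mem hne)
      exact ⟨_, _, h1.1, h2.2, csInf_le_csSup hne hK.bddBelow hK.bddAbove,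
        fun x hx => ⟨csInf_le hK.bddBelow hx, le_csSup hK.bddAbove hx⟩⟩
  have hz : ∀ x, x ∉ Icc c d → φ x = 0 := fun x hx =>
    image_eq_zero_of_notMem_tsupport fun h' => hx (hsub h')
  have hT0 : Φ T = 0 := by
    rw [hΦ]; simp only
    rw [intervalIntegral.integral_of_le hT.le, integral_Ioc_eq_integral_Ioo, h0]
  -- Left of `c` nothing has been integrated yet; right of `d` the value is already `Φ T`, which is
  -- the total integral, zero.
  have hzero : ∀ x, x ∉ Icc c d → Φ x = 0 := by
    intro x hx
    rcases lt_or_ge x c with h1 | h1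
    · refine intervalIntegral.integral_zero_ae (Eventually.of_forall fun t ht => hz t fun h' => ?_)
      have := ht.2
      have h3 := h'.1
      rcases max_cases 0 x with h4 | h4 <;> linarith
    · have h2 : d < x := by
        by_contra h2
        exact hx ⟨h1, not_lt.1 h2⟩
      have : ∫ t in x..T, φ t = 0 := by
        refine intervalIntegral.integral_zero_ae
          (Eventually.of_forall fun t ht => hz t fun h' => ?_)
        have := ht.1
        have h3 := h'.2
        rcases min_cases x T with h4 | h4 <;> linarith
      have h5 := intervalIntegral.integral_add_adjacent_intervals
        (h.continuous.intervalIntegrable (μ := volume) 0 x) (h.continuous.intervalIntegrable x T)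
      rw [this, add_zero] at h5
      rw [← hT0, hΦ]
      exact h5
  refine ⟨Φ, ⟨?_, ?_, ?_⟩, hderiv⟩
  · exact contDiff_infty_iff_deriv.2 ⟨fun x => (hd x).differentiableAt, hderiv ▸ h.1⟩
  · exact HasCompactSupport.intro isCompact_Icc fun x hx => hzero x hx
  · refine (closure_minimal (fun x hx => ?_) isClosed_Icc).trans
      (fun x (hx : x ∈ Icc c d) => ⟨hc.trans_le hx.1, hx.2.trans_lt hd'⟩)
    by_contra h'
    exact hx (hzero x h')

/-- Lemma of du Bois-Reymond. -/
theorem HasWeakDeriv.ae_eq_const {T : ℝ} (hT : 0 < T) {g : ℝ → ℝ}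
    (h : HasWeakDeriv T g (fun _ => 0)) :
    ∃ c, g =ᵐ[volume.restrict (Ioo 0 T)] fun _ => c := by
  obtain ⟨ψ, hψ, hψ0, hψ1⟩ := exists_test_eq_one (T := T) (δ := T / 4) (by linarith) (by linarith)
  have hψi : ∀ {φ}, IsTestFunction T φ → IntegrableOn φ (Ioo 0 T) := fun hφ =>
    (memLp_one_iff_integrable.1 (hφ.memLp 1) :)
  have hpos : 0 < ∫ x in Ioo 0 T, ψ x := by
    rw [integral_pos_iff_support_of_nonneg hψ0 (hψi hψ)]
    refine lt_of_lt_of_le ?_ (measure_mono (s := Ioo (T / 4) (T - T / 4)) ?_)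
    · rw [Measure.restrict_apply measurableSet_Ioo, inter_eq_left.2, Real.volume_Ioo]
      · simp; linarith
      · intro x hx; exact ⟨by linarith [hx.1], by linarith [hx.2]⟩
    · intro x hx
      simp [hψ1 x (Ioo_subset_Icc_self hx)]
  set I := ∫ x in Ioo 0 T, ψ x with hI
  refine ⟨(∫ x in Ioo 0 T, g x * ψ x) / I, ae_eq_of_forall_integral_mul_test h.1
    (continuous_const.locallyIntegrable.locallyIntegrableOn _) fun φ hφ => ?_⟩
  set J := ∫ x in Ioo 0 T, φ x with hJ
  -- Subtracting this multiple of the bump makes the integral zero, so the result is the derivative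
  -- of a test function.
  have hη : IsTestFunction T (φ + (-(J / I)) • ψ) := hφ.add (hψ.smul _)
  obtain ⟨Φ, hΦ, hΦ'⟩ := hη.exists_primitive hT (by
    simp only [Pi.add_apply, Pi.smul_apply, smul_eq_mul]
    rw [integral_add (hψi hφ) ((hψi hψ).const_mul _), integral_const_mul, ← hI, ← hJ]
    field_simp; ring)
  have := h.2.2 Φ hΦ
  rw [hΦ'] at this
  simp only [Pi.add_apply, Pi.smul_apply, smul_eq_mul, zero_mul, integral_zero, neg_zero] at this
  have e : ∀ x, g x * (φ x + -(J / I) * ψ x) = g x * φ x + (-(J / I)) * (g x * ψ x) :=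
    fun x => by ring
  simp only [e] at this
  rw [integral_add (hφ.integrable_mul h.1) ((hψ.integrable_mul h.1).const_mul _),
    integral_const_mul] at this
  rw [integral_const_mul, ← hJ]
  field_simp at this ⊢
  linarith

/-- A function with an integrable weak derivative has an absolutely continuous representative. -/
theorem HasWeakDeriv.ae_eq_primitive {T : ℝ} (hT : 0 < T) {u w : ℝ → ℝ}
    (h : HasWeakDeriv T u w) (hw : Integrable w) :
    ∃ c, u =ᵐ[volume.restrict (Ioo 0 T)] fun x => c + ∫ t in (0 : ℝ)..x, w t := by
  have h1 := h.add ((hasWeakDeriv_primitive hT hw).const_mul (-1))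
  obtain ⟨c, hc⟩ := (h1.congr_ae (ae_eq_refl _)
    (z := fun _ => 0) (Eventually.of_forall fun x => by ring)).ae_eq_const hT
  refine ⟨c, hc.mono fun x hx => ?_⟩
  simp only at hx ⊢
  linarith

/-! ### Differentiating the energy when `a` is only Lipschitz -/

/-- A function has zero derivative at almost every point that it maps into a given null set. -/
theorem ae_eq_zero_of_hasDerivAt_of_mem_null (f : ℝ → ℝ) {N : Set ℝ} (hN : volume N = 0) :
    ∀ᵐ x, f x ∈ N → ∀ d, HasDerivAt f d x → d = 0 := by
  -- A point with nonzero derivative expands distances by at least `1/(n+1)` at scale `1/(n+1)` for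
  -- some `n`. The floor condition cuts the line into cells shorter than this scale, so `f` is
  -- antilipschitz on each `E n k`, which is therefore null because its image lies in `N`.
  let E : ℕ → ℤ → Set ℝ := fun n k => {x | f x ∈ N ∧
    (∀ y, |y - x| < 1 / ((n : ℝ) + 1) → |y - x| ≤ ((n : ℝ) + 1) * |f y - f x|) ∧
    ⌊x * ((n : ℝ) + 1)⌋ = k}
  have hE : ∀ n k, volume (E n k) = 0 := by
    intro n k
    have hn : (0 : ℝ) < (n : ℝ) + 1 := by positivity
    have hanti : AntilipschitzWith ((n : ℝ≥0) + 1) ((E n k).domRestrict f) := by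
      refine AntilipschitzWith.of_le_mul_dist fun x y => ?_
      have h1 := Int.abs_sub_lt_one_of_floor_eq_floor (x.2.2.2.trans y.2.2.2.symm)
      rw [← sub_mul, abs_mul, abs_of_pos hn, ← lt_div_iff₀ hn] at h1
      have := y.2.2.1 x h1
      simpa [Subtype.dist_eq, Real.dist_eq, domRestrict_apply] using this
    have h2 := hanti.hausdorffMeasure_preimage_le zero_le_one N
    have h3 : ((E n k).domRestrict f) ⁻¹' N = univ := eq_univ_of_forall fun x => x.2.1
    rw [hausdorffMeasure_real, hN, mul_zero, h3] at h2
    have h4 := (isometry_subtype_coe (s := E n k)).hausdorffMeasure_image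
      (d := 1) (Or.inl zero_le_one) univ
    rw [image_univ, Subtype.range_coe, hausdorffMeasure_real] at h4
    rw [h4]
    exact le_antisymm h2 zero_le
  have hU : volume (⋃ n, ⋃ k, E n k) = 0 :=
    measure_iUnion_null fun n => measure_iUnion_null fun k => hE n k
  rw [ae_iff]
  refine measure_mono_null (fun x hx => ?_) hU
  simp only [mem_ofPred_eq, not_forall] at hx
  obtain ⟨hxN, d, hd, hd0⟩ := hx
  obtain ⟨C, hC⟩ := (HasDerivAtFilter.isTheta_sub hd hd0).2.bound
  rw [prod_pure, eventually_map] at hC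
  obtain ⟨ε, hε, hεC⟩ := Metric.eventually_nhds_iff.1 hC
  obtain ⟨n, hn⟩ := exists_nat_gt (max C (1 / ε))
  have hn1 : C < n := (le_max_left _ _).trans_lt hn
  have hn2 : 1 / ε < n := (le_max_right _ _).trans_lt hn
  refine mem_iUnion.2 ⟨n, mem_iUnion.2 ⟨_, hxN, fun y hy => ?_, rfl⟩⟩
  have h1 : 1 / ((n : ℝ) + 1) < ε := by
    rw [div_lt_comm₀ (by positivity) hε]; linarith
  have h2 := hεC (y := y) (by rw [Real.dist_eq]; linarith)
  simp only [Real.norm_eq_abs] at h2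
  exact h2.trans (mul_le_mul_of_nonneg_right (by linarith) (abs_nonneg _))

/-- By Rademacher the bad values of `a` form a null set, and `f` can reach them with nonzero
derivative only on a null set. -/
theorem LipschitzWith.ae_differentiableAt_of_hasDerivAt_ne_zero {a : ℝ → ℝ} {La : ℝ≥0}
    (ha : LipschitzWith La a) (f : ℝ → ℝ) :
    ∀ᵐ x, ∀ d, HasDerivAt f d x → d ≠ 0 → DifferentiableAt ℝ a (f x) := by
  have hN : volume {y | ¬ DifferentiableAt ℝ a y} = 0 := ha.ae_differentiableAt_real
  filter_upwards [ae_eq_zero_of_hasDerivAt_of_mem_null f hN] with x hx d hd hd0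
  by_contra h
  exact hd0 (hx h d hd)

/-- The derivative of `a(p+tφ)(w+tψ)²` at `t = 0`, where `a` need only be differentiable at `p`
when `w ≠ 0`. -/
theorem hasDerivAt_mul_sq {a : ℝ → ℝ} (ha : Continuous a) {p w φ ψ : ℝ}
    (h : w ≠ 0 → DifferentiableAt ℝ a p) :
    HasDerivAt (fun t => a (p + t * φ) * (w + t * ψ) ^ 2)
      (2 * a p * w * ψ + deriv a p * w ^ 2 * φ) 0 := by
  by_cases hw : w = 0
  -- Here the difference quotient is `a(p+tφ) t ψ²`, which tends to `0` by continuity of `a` alone.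
  · subst hw
    rw [hasDerivAt_iff_tendsto_slope_zero]
    have h1 : Tendsto (fun t => a (p + t * φ) * (t * ψ ^ 2)) (𝓝[≠] 0)
        (𝓝 (2 * a p * 0 * ψ + deriv a p * 0 ^ 2 * φ)) := by
      have : Continuous fun t => a (p + t * φ) * (t * ψ ^ 2) := by fun_prop
      simpa using (this.tendsto 0).mono_left nhdsWithin_le_nhds
    refine h1.congr' ?_
    filter_upwards [self_mem_nhdsWithin] with t ht
    have ht : t ≠ 0 := ht
    simp only [zero_add, smul_eq_mul, zero_mul]
    field_simp
    ring
  · have h1 : HasDerivAt (fun t : ℝ => p + t * φ) φ 0 := by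
      simpa using ((hasDerivAt_id (0 : ℝ)).mul_const φ).const_add p
    have h2 : HasDerivAt (fun t : ℝ => w + t * ψ) ψ 0 := by
      simpa using ((hasDerivAt_id (0 : ℝ)).mul_const ψ).const_add w
    have h3 : HasDerivAt a (deriv a p) (p + 0 * φ) := by simpa using (h hw).hasDerivAt
    have h4 := (h3.comp 0 h1).mul (h2.pow 2)
    convert! h4 using 1
    simp
    ring

theorem LipschitzWith.abs_comp_le {g : ℝ → ℝ} {L : ℝ≥0} (hg : LipschitzWith L g) {C y : ℝ}
    (hy : |y| ≤ C) : |g y| ≤ |g 0| + L * C := by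
  have h1 : |g y - g 0| ≤ L * |y - 0| := hg.dist_le_mul _ _
  rw [sub_zero] at h1
  have h2 := mul_le_mul_of_nonneg_left hy L.2
  have h3 := abs_sub_abs_le_abs_sub (g y) (g 0)
  simp only [NNReal.val_eq_coe] at h2
  linarith

/-- Supplies the dominating function for differentiation under the integral: the Lipschitz constant
in `t` is quadratic in `|w|`, hence integrable for `w` in `L^2`. -/
theorem abs_energy_density_sub_le {a b : ℝ → ℝ} {La Lb : ℝ≥0} (ha : LipschitzWith La a)
    (hb : LipschitzWith Lb b) {C M p w φ ψ s t : ℝ} (hp : |p| ≤ C)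
    (hφ : |φ| ≤ M) (hψ : |ψ| ≤ M) (hs : |s| ≤ 1) (ht : |t| ≤ 1) :
    |(a (p + s * φ) * (w + s * ψ) ^ 2 + b (p + s * φ))
        - (a (p + t * φ) * (w + t * ψ) ^ 2 + b (p + t * φ))|
      ≤ (La * M * (|w| + M) ^ 2 + (|a 0| + La * (C + M)) * (M * (2 * (|w| + M))) + Lb * M)
        * |s - t| := by
  have hM : 0 ≤ M := (abs_nonneg _).trans hφ
  have hC : 0 ≤ C := (abs_nonneg _).trans hp
  have hdiff : ∀ η : ℝ, |η| ≤ M → |s * η - t * η| ≤ M * |s - t| := fun η hη => by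
    rw [← sub_mul, abs_mul, mul_comm]
    exact mul_le_mul_of_nonneg_right hη (abs_nonneg _)
  have hmul : ∀ r η : ℝ, |r| ≤ 1 → |η| ≤ M → |r * η| ≤ M := fun r η hr hη => by
    rw [abs_mul]
    calc |r| * |η| ≤ 1 * M := mul_le_mul hr hη (abs_nonneg _) zero_le_one
      _ = M := one_mul M
  have hpq : |(p + s * φ) - (p + t * φ)| ≤ M * |s - t| := by
    rw [add_sub_add_left_eq_sub]; exact hdiff φ hφ
  have h1 : |a (p + s * φ) - a (p + t * φ)| ≤ La * (M * |s - t|) :=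
    (ha.dist_le_mul _ _).trans (mul_le_mul_of_nonneg_left hpq La.2)
  have h2 : |b (p + s * φ) - b (p + t * φ)| ≤ Lb * (M * |s - t|) :=
    (hb.dist_le_mul _ _).trans (mul_le_mul_of_nonneg_left hpq Lb.2)
  have h3 : |a (p + t * φ)| ≤ |a 0| + La * (C + M) :=
    ha.abs_comp_le ((abs_add_le _ _).trans (add_le_add hp (hmul _ _ ht hφ)))
  have hP : |w + s * ψ| ≤ |w| + M := (abs_add_le _ _).trans (add_le_add_right (hmul _ _ hs hψ) _)
  have hQ : |w + t * ψ| ≤ |w| + M := (abs_add_le _ _).trans (add_le_add_right (hmul _ _ ht hψ) _)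
  have e : (a (p + s * φ) * (w + s * ψ) ^ 2 + b (p + s * φ))
        - (a (p + t * φ) * (w + t * ψ) ^ 2 + b (p + t * φ))
      = (a (p + s * φ) - a (p + t * φ)) * (w + s * ψ) ^ 2
        + a (p + t * φ) * ((s * ψ - t * ψ) * ((w + s * ψ) + (w + t * ψ)))
        + (b (p + s * φ) - b (p + t * φ)) := by ring
  rw [e]
  have k1 : |(a (p + s * φ) - a (p + t * φ)) * (w + s * ψ) ^ 2|
      ≤ La * (M * |s - t|) * (|w| + M) ^ 2 := by
    rw [abs_mul, abs_pow]
    gcongr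
  have k2 : |a (p + t * φ) * ((s * ψ - t * ψ) * ((w + s * ψ) + (w + t * ψ)))|
      ≤ (|a 0| + La * (C + M)) * ((M * |s - t|) * (2 * (|w| + M))) := by
    rw [abs_mul, abs_mul]
    gcongr
    · exact hdiff ψ hψ
    · exact (abs_add_le _ _).trans (by linarith)
  calc _ ≤ _ := (abs_add_le _ _).trans (add_le_add ((abs_add_le _ _).trans (add_le_add k1 k2)) h2)
    _ = _ := by ring

/-- Gateaux derivative of the energy. -/
theorem hasDerivAt_integral_energy {μ : Measure ℝ} [IsFiniteMeasure μ] {a b : ℝ → ℝ} {La Lb : ℝ≥0}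
    (ha : LipschitzWith La a) (hb : LipschitzWith Lb b) (hb' : Differentiable ℝ b)
    {U w φ ψ : ℝ → ℝ} {C M : ℝ} (hU : Continuous U) (hUC : ∀ x, |U x| ≤ C) (hw : MemLp w 2 μ)
    (hφ : Continuous φ) (hψ : Continuous ψ) (hφM : ∀ x, |φ x| ≤ M) (hψM : ∀ x, |ψ x| ≤ M)
    (hae : ∀ᵐ x ∂μ, w x ≠ 0 → DifferentiableAt ℝ a (U x)) :
    Integrable (fun x => 2 * a (U x) * w x * ψ x + deriv a (U x) * w x ^ 2 * φ x
        + deriv b (U x) * φ x) μ ∧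
      HasDerivAt (fun t => ∫ x, (a (U x + t * φ x) * (w x + t * ψ x) ^ 2 + b (U x + t * φ x)) ∂μ)
        (∫ x, (2 * a (U x) * w x * ψ x + deriv a (U x) * w x ^ 2 * φ x
          + deriv b (U x) * φ x) ∂μ) 0 := by
  have hac := ha.continuous
  have hbc := hb.continuous
  have hwm := hw.1
  have hwi : Integrable (fun x => |w x| + M) μ :=
    ((hw.integrable one_le_two).abs).add (integrable_const M)
  have hwi2 : Integrable (fun x => (|w x| + M) ^ 2) μ :=
    (MemLp.add hw.abs (memLp_const M)).integrable_sq
  refine hasDerivAt_integral_of_dominated_loc_of_lip (Metric.ball_mem_nhds (0 : ℝ) one_pos)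
    (bound := fun x => La * M * (|w x| + M) ^ 2
      + (|a 0| + La * (C + M)) * (M * (2 * (|w x| + M))) + Lb * M)
    (Eventually.of_forall fun t => ?_) ?_ ?_ (Eventually.of_forall fun x => ?_) ?_ ?_
  · have h1 : Continuous fun x => a (U x + t * φ x) := by fun_prop
    have h2 : Continuous fun x => b (U x + t * φ x) := by fun_prop
    exact (h1.aestronglyMeasurable.mul
      ((hwm.add (continuous_const.mul hψ).aestronglyMeasurable).pow 2)).add h2.aestronglyMeasurable
  · simp only [zero_mul, add_zero]
    refine Integrable.add ?_ ?_
    · exact hw.integrable_sq.bdd_mul (c := |a 0| + La * C) (hac.comp hU).aestronglyMeasurable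
        (Eventually.of_forall fun x => ha.abs_comp_le (hUC x))
    · exact Integrable.of_bound (hbc.comp hU).aestronglyMeasurable _
        (Eventually.of_forall fun x => hb.abs_comp_le (hUC x))
  · have h1 : AEStronglyMeasurable (fun x => deriv a (U x)) μ :=
      ((measurable_deriv a).comp hU.measurable).aestronglyMeasurable
    have h2 : AEStronglyMeasurable (fun x => deriv b (U x)) μ :=
      ((measurable_deriv b).comp hU.measurable).aestronglyMeasurable
    have h3 : AEStronglyMeasurable (fun x => 2 * a (U x)) μ :=
      (continuous_const.mul (hac.comp hU)).aestronglyMeasurable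
    have hφm := hφ.aestronglyMeasurable (μ := μ)
    have hψm := hψ.aestronglyMeasurable (μ := μ)
    exact (((h3.mul hwm).mul hψm).add ((h1.mul (hwm.pow 2)).mul hφm)).add (h2.mul hφm)
  · refine LipschitzOnWith.of_dist_le_mul fun s hs t ht => ?_
    rw [mem_ball_zero_iff, Real.norm_eq_abs] at hs ht
    rw [Real.dist_eq, Real.dist_eq]
    refine (abs_energy_density_sub_le ha hb (hUC x) (hφM x) (hψM x) hs.le ht.le).trans ?_
    simp only [Real.coe_nnabs]
    exact mul_le_mul_of_nonneg_right (le_abs_self _) (abs_nonneg _)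
  · exact ((hwi2.const_mul _).add (((hwi.const_mul 2).const_mul M).const_mul _)).add
      (integrable_const _)
  · filter_upwards [hae] with x hx
    refine (hasDerivAt_mul_sq hac hx).add ?_
    have h1 : HasDerivAt (fun t : ℝ => U x + t * φ x) (φ x) 0 := by
      simpa using ((hasDerivAt_id (0 : ℝ)).mul_const (φ x)).const_add (U x)
    have h3 : HasDerivAt b (deriv b (U x)) (U x + 0 * φ x) := by simpa using (hb' _).hasDerivAt
    exact h3.comp 0 h1

/-! ### Abstract Lagrange multipliers in `C(X, ℝ)` -/

open scoped CompactlySupported in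
/-- Riesz–Markov–Kakutani on a compact space: a positive linear functional on `C(X, ℝ)` is
represented by a finite measure. -/
theorem ContinuousMap.exists_measure_of_nonneg {X : Type*} [TopologicalSpace X] [T2Space X]
    [CompactSpace X] [MeasurableSpace X] [BorelSpace X] (g : C(X, ℝ) →ₗ[ℝ] ℝ)
    (hg : ∀ y, 0 ≤ y → 0 ≤ g y) :
    ∃ μ : Measure X, IsFiniteMeasure μ ∧ ∀ y : C(X, ℝ), ∫ x, y x ∂μ = g y := by
  let J : C_c(X, ℝ) →ₗ[ℝ] C(X, ℝ) :=
    { toFun := fun f => f.toContinuousMap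
      map_add' := fun _ _ => rfl
      map_smul' := fun _ _ => rfl }
  let Λ : C_c(X, ℝ) →ₚ[ℝ] ℝ := PositiveLinearMap.mk₀ (g ∘ₗ J) fun y hy => hg (J y) hy
  refine ⟨RealRMK.rieszMeasure Λ, inferInstance, fun y => ?_⟩
  exact RealRMK.integral_rieszMeasure Λ
    (CompactlySupportedContinuousMap.continuousMapEquiv y)

/-- Lagrange multiplier for the linear inequality constraint `0 ≤ β + B φ` in `C(X, ℝ)`, under
Slater's condition. -/
theorem exists_multiplier_measure {X V : Type*} [TopologicalSpace X] [T2Space X]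
    [CompactSpace X] [MeasurableSpace X] [BorelSpace X] [AddCommGroup V] [Module ℝ V]
    (B : V →ₗ[ℝ] C(X, ℝ)) (L : V →ₗ[ℝ] ℝ) (β : C(X, ℝ)) (hβ : 0 ≤ β)
    (hL : ∀ φ, 0 ≤ β + B φ → 0 ≤ L φ) (hS : ∃ φ, ∃ c > 0, ∀ x, c ≤ B φ x) :
    ∃ μ : Measure X, IsFiniteMeasure μ ∧ (∀ φ, ∫ x, B φ x ∂μ = L φ) ∧ ∫ x, β x ∂μ = 0 := by
  let j : V × ℝ →ₗ[ℝ] C(X, ℝ) := B.coprod ((LinearMap.id : ℝ →ₗ[ℝ] ℝ).smulRight β)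
  let l : V × ℝ →ₗ[ℝ] ℝ := L ∘ₗ LinearMap.fst ℝ V ℝ
  have hpos : ∀ q, 0 ≤ j q → 0 ≤ l q := by
    rintro ⟨φ, s⟩ h
    have h0 : 0 ≤ B φ + s • β := h
    -- Since `β ≥ 0`, raising `s` to `max s 1` preserves the inequality, and dividing by this
    -- positive number gives a direction to which `hL` applies.
    have hr : 0 < max s 1 := lt_max_of_lt_right one_pos
    have h1 : 0 ≤ B φ + (max s 1) • β :=
      h0.trans (add_le_add_right (smul_le_smul_of_nonneg_right (le_max_left _ _) hβ) _)
    have h2 := smul_nonneg (inv_nonneg.2 hr.le) h1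
    rw [smul_add, smul_smul, inv_mul_cancel₀ hr.ne', one_smul, ← map_smul, add_comm] at h2
    have h3 := hL _ h2
    rw [map_smul, smul_eq_mul] at h3
    exact nonneg_of_mul_nonneg_right h3 (inv_pos.2 hr)
  -- Positivity at both `q` and `-q` forces `l = 0` on the kernel of `j`, so `l` factors through the
  -- range of `j`.
  have hker : l ∈ j.ker.dualAnnihilator := by
    rw [Submodule.mem_dualAnnihilator]
    intro q hq
    rw [LinearMap.mem_ker] at hq
    refine le_antisymm ?_ (hpos q hq.ge)
    have := hpos (-q) (by rw [map_neg, hq, neg_zero])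
    rw [map_neg] at this
    linarith
  rw [← LinearMap.range_dualMap_eq_dualAnnihilator_ker] at hker
  obtain ⟨k, hk⟩ := hker
  have hk' : ∀ q, k (j q) = l q := fun q => LinearMap.congr_fun hk q
  obtain ⟨g, hg1, hg2⟩ := riesz_extension (PointedCone.positive ℝ C(X, ℝ))
    ⟨LinearMap.range j, k.domRestrict _⟩
    (by
      rintro ⟨_, q, rfl⟩ hq
      rw [PointedCone.mem_positive] at hq
      have := hpos q hq
      rw [← hk'] at this
      exact this)
    (by
      -- Slater's condition makes the range cofinal: a multiple of `B φ` exceeds `‖y‖`, as the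
      -- extension theorem requires.
      obtain ⟨φ, c, hc, hφ⟩ := hS
      intro y
      refine ⟨⟨_, ((‖y‖ / c) • φ, 0), rfl⟩, ?_⟩
      rw [PointedCone.mem_positive, ContinuousMap.le_def]
      intro x
      have h1 : -‖y‖ ≤ y x := (abs_le.1 (y.norm_coe_le_norm x)).1
      have h2 := mul_le_mul_of_nonneg_left (hφ x) (div_nonneg (norm_nonneg y) hc.le)
      rw [div_mul_cancel₀ _ hc.ne'] at h2
      simp only [j, LinearMap.coprod_apply, map_smul, map_zero, add_zero,
        ContinuousMap.zero_apply, ContinuousMap.add_apply, ContinuousMap.smul_apply, smul_eq_mul]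
      linarith)
  have hgj : ∀ q, g (j q) = l q := fun q => (hg1 ⟨j q, q, rfl⟩).trans (hk' q)
  obtain ⟨μ, hμ, hint⟩ := ContinuousMap.exists_measure_of_nonneg g fun y hy => hg2 y hy
  refine ⟨μ, hμ, fun φ => ?_, ?_⟩
  · rw [hint]
    have := hgj (φ, 0)
    simpa [j, l] using this
  · rw [hint]
    have := hgj (0, 1)
    simpa [j, l] using this

/-! ### The averaging operator and its adjoint -/

theorem measurableSet_window : MeasurableSet {p : ℝ × ℝ | p.2 ∈ Icc p.1 (p.1 + 1)} :=
  (measurableSet_le measurable_fst measurable_snd).inter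
    (measurableSet_le measurable_snd (measurable_fst.add_const 1))

theorem measurable_measureReal_window (f : Measure ℝ) [IsFiniteMeasure f] :
    Measurable fun s => f.real (Icc (s - 1) s) := by
  have h := measurable_measure_prodMk_right (μ := f) measurableSet_window
  convert! h.ennreal_toReal using 1
  funext s
  rw [Measure.real]
  congr 2
  ext x
  simp only [mem_preimage, mem_Icc, mem_ofPred_eq]
  constructor <;> rintro ⟨h1, h2⟩ <;> constructor <;> linarith

/-- The adjoint of the constraint operator maps `f` to `s ↦ f([s-1,s])`. -/
theorem integral_opB (f : Measure ℝ) [IsFiniteMeasure f] {φ : ℝ → ℝ} (hφ : Integrable φ) :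
    ∫ x, opB φ x ∂f = ∫ s, f.real (Icc (s - 1) s) * φ s := by
  let D : Set (ℝ × ℝ) := {p | p.2 ∈ Icc p.1 (p.1 + 1)}
  have hi : Integrable (D.indicator fun p => φ p.2) (f.prod volume) :=
    (hφ.comp_snd f).indicator measurableSet_window
  have h1 : ∀ x, opB φ x = ∫ s, D.indicator (fun p => φ p.2) (x, s) := by
    intro x
    rw [opB, intervalIntegral.integral_of_le (by linarith), ← integral_Icc_eq_integral_Ioc,
      ← integral_indicator measurableSet_Icc]
    rfl
  have h2 : ∀ s, ∫ x, D.indicator (fun p => φ p.2) (x, s) ∂f = f.real (Icc (s - 1) s) * φ s := by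
    intro s
    have : (fun x => D.indicator (fun p => φ p.2) (x, s))
        = (Icc (s - 1) s).indicator fun _ => φ s := by
      funext x
      by_cases hx : x ∈ Icc (s - 1) s
      · have : (x, s) ∈ D := ⟨hx.2, by linarith [hx.1]⟩
        rw [indicator_of_mem hx, indicator_of_mem this]
      · have : (x, s) ∉ D := fun h => hx ⟨by linarith [h.2], h.1⟩
        rw [indicator_of_notMem hx, indicator_of_notMem this]
    rw [this, integral_indicator_const _ measurableSet_Icc, smul_eq_mul]
  simp_rw [h1, ← h2]
  exact integral_integral_swap hi

/-- The test functions on `(0,T)` as a vector space. -/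
def testSpace (T : ℝ) : Submodule ℝ (ℝ → ℝ) where
  carrier := {φ | IsTestFunction T φ}
  add_mem' h h' := h.add h'
  zero_mem' := IsTestFunction.zero T
  smul_mem' c _ h := h.smul c

theorem opB_congr_ae {T : ℝ} {v v' : ℝ → ℝ} (h : v =ᵐ[volume.restrict (Ioo 0 T)] v') {x : ℝ}
    (hx : x ∈ Icc 0 (T - 1)) : opB v x = opB v' x := by
  refine intervalIntegral.integral_congr_ae_restrict ?_
  rw [Measure.restrict_congr_set Ioo_ae_eq_Ioc] at h
  refine ae_restrict_of_ae_restrict_of_subset ?_ h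
  rw [uIoc_of_le (by linarith)]
  exact Ioc_subset_Ioc hx.1 (by linarith [hx.2])

theorem continuous_opB {v : ℝ → ℝ} (hv : Continuous v) : Continuous (opB v) := by
  have h := intervalIntegral.continuous_primitive (μ := volume)
    (fun a b => hv.intervalIntegrable a b) 0
  have e : opB v = fun x => (∫ s in (0 : ℝ)..(x + 1), v s) - ∫ s in (0 : ℝ)..x, v s := by
    funext x
    exact (intervalIntegral.integral_interval_sub_left (hv.intervalIntegrable _ _)
      (hv.intervalIntegrable _ _)).symm
  rw [e]
  exact (h.comp (continuous_id.add continuous_const)).sub h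

theorem opB_add_mul {v φ : ℝ → ℝ} (hv : Continuous v) (hφ : Continuous φ) (t x : ℝ) :
    opB (fun s => v s + t * φ s) x = opB v x + t * opB φ x := by
  have hφt : Continuous fun s => t * φ s := continuous_const.mul hφ
  unfold opB
  rw [← intervalIntegral.integral_const_mul]
  exact intervalIntegral.integral_add (hv.intervalIntegrable _ _) (hφt.intervalIntegrable _ _)

/-- The averaging operator as a linear map from test functions to `C([0,T-1])`. -/
noncomputable def opBTest (T : ℝ) : testSpace T →ₗ[ℝ] C(Icc (0 : ℝ) (T - 1), ℝ) where
  toFun φ := ⟨fun x => opB φ.1 x, (continuous_opB (IsTestFunction.continuous φ.2)).comp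
    continuous_subtype_val⟩
  map_add' φ ψ := by
    ext x
    have := opB_add_mul (IsTestFunction.continuous φ.2) (IsTestFunction.continuous ψ.2) 1 x
    simp only [one_mul] at this
    exact this
  map_smul' c φ := by
    ext x
    exact intervalIntegral.integral_const_mul c φ.1

/-- Slater's condition: a bump equal to `1` at distance at least `δ ≤ 1/4` from the endpoints is `1`
on the middle `1 - 2δ` of every unit window in `[0,T]`. -/
theorem exists_test_opB_ge {T : ℝ} (hT : 0 < T) :
    ∃ φ : testSpace T, ∃ c > 0, ∀ x, c ≤ opBTest T φ x := by
  have hδ : 0 < min (1 / 4) (T / 4) := by positivity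
  set δ := min (1 / 4) (T / 4) with hδd
  have hδ1 : δ ≤ 1 / 4 := min_le_left _ _
  have hδ2 : δ ≤ T / 4 := min_le_right _ _
  obtain ⟨φ, hφ, hφ0, hφ1⟩ := exists_test_eq_one (T := T) hδ (by linarith)
  refine ⟨⟨φ, hφ⟩, 1 - 2 * δ, by linarith, fun ⟨x, hx⟩ => ?_⟩
  have h1 : ∫ s in (x + δ)..(x + 1 - δ), φ s = 1 - 2 * δ := by
    rw [intervalIntegral.integral_congr (g := fun _ => (1 : ℝ))]
    · simp; ring
    · intro s hs
      rw [uIcc_of_le (by linarith)] at hs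
      exact hφ1 s ⟨by linarith [hs.1, hx.1], by linarith [hs.2, hx.2]⟩
  rw [← h1]
  exact intervalIntegral.integral_mono_interval (by linarith) (by linarith) (by linarith)
    (Eventually.of_forall hφ0) (hφ.continuous.intervalIntegrable _ _)

/-! ### Representatives and perturbations in the affine space -/

/-- Elements of `U` have a continuous bounded representative that is a primitive. -/
theorem spaceU.exists_representative {T : ℝ} (hT : 0 < T) {u : ℝ → ℝ} (hu : u ∈ spaceU T) :
    ∃ w : ℝ → ℝ, ∃ c : ℝ, HasWeakDeriv T u w ∧ Integrable w ∧ MemLp w 2 (intervalMeasure T) ∧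
      (∀ x ∉ Ioo 0 T, w x = 0) ∧
      u =ᵐ[volume.restrict (Ioo 0 T)] fun x => c + ∫ t in (0 : ℝ)..x, w t := by
  obtain ⟨⟨-, w, hw, hw2⟩, -⟩ := hu
  have hw2 : MemLp w 2 (intervalMeasure T) := hw2
  have hfin : IsFiniteMeasure (intervalMeasure T) := by unfold intervalMeasure; infer_instance
  have hind : w =ᵐ[volume.restrict (Ioo 0 T)] (Ioo 0 T).indicator w :=
    (indicator_ae_eq_restrict measurableSet_Ioo).symm
  have h1 : HasWeakDeriv T u ((Ioo 0 T).indicator w) :=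
    (hw.add (hasWeakDeriv_const hT 1)).congr_ae (Eventually.of_forall fun x => by simp)
      (by simpa using hind)
  have h2 : Integrable ((Ioo 0 T).indicator w) :=
    (integrable_indicator_iff measurableSet_Ioo).2 (hw2.integrable one_le_two)
  obtain ⟨c, hc⟩ := h1.ae_eq_primitive hT h2
  exact ⟨_, c, h1, h2, hw2.ae_eq hind, fun x hx => indicator_of_notMem hx _, hc⟩

theorem spaceU.add_test {T : ℝ} (hT : 0 < T) {u φ : ℝ → ℝ} (hu : u ∈ spaceU T)
    (hφ : IsTestFunction T φ) : (fun x => u x + φ x) ∈ spaceU T := by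
  obtain ⟨⟨h1, w, hw, hw2⟩, happ⟩ := hu
  have hw2 : MemLp w 2 (intervalMeasure T) := hw2
  have hwd : HasWeakDeriv T (fun x => u x + φ x - 1) (fun x => w x + deriv φ x) :=
    (hw.add (hφ.hasWeakDeriv hT)).congr_ae (Eventually.of_forall fun x => by ring) (ae_eq_refl _)
  refine ⟨⟨?_, _, hwd, hw2.add (hφ.deriv.memLp 2)⟩, fun ε hε => ?_⟩
  · convert! h1.add (hφ.memLp 2) using 1
    funext x
    simp only [Pi.add_apply]
    ring
  · obtain ⟨ψ, hψ, hψ1, hψ2⟩ := happ ε hε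
    refine ⟨ψ + φ, hψ.add hφ, ?_, ?_⟩
    · convert! hψ1 using 2
      funext x
      simp only [Pi.add_apply]
      ring
    · refine lt_of_eq_of_lt (eLpNorm_congr_ae ?_) hψ2
      have h3 : weakDeriv T (fun x => u x + φ x - 1) =ᵐ[intervalMeasure T]
        fun x => w x + deriv φ x := hwd.weakDeriv_ae_eq
      have h4 : weakDeriv T (fun x => u x - 1) =ᵐ[intervalMeasure T] w := hw.weakDeriv_ae_eq
      filter_upwards [h3, h4] with x hx3 hx4
      rw [hx3, hx4, deriv_add hψ.differentiable.differentiableAt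
        hφ.differentiable.differentiableAt]
      ring

theorem nonneg_of_hasDerivAt_of_le {g : ℝ → ℝ} {d : ℝ} (hg : HasDerivAt g d 0)
    (h : ∀ t ∈ Ioc (0 : ℝ) 1, g 0 ≤ g t) : 0 ≤ d := by
  have h1 := (hasDerivAt_iff_tendsto_slope_zero.1 hg).mono_left
    (nhdsWithin_mono 0 (fun x (hx : x ∈ Ioi (0 : ℝ)) => (ne_of_gt hx : x ≠ 0)))
  refine ge_of_tendsto h1 ?_
  filter_upwards [Ioc_mem_nhdsGT (zero_lt_one' ℝ)] with t ht
  rw [zero_add, smul_eq_mul]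
  exact mul_nonneg (inv_nonneg.2 ht.1.le) (sub_nonneg.2 (h t ht))

/-! ### First-order condition and the multiplier -/

section FirstOrder

variable {T : ℝ} {a b : ℝ → ℝ} {La Lb : ℝ≥0} {u w : ℝ → ℝ} {c : ℝ}

theorem continuous_primitive_add (hw : Integrable w) (c : ℝ) :
    Continuous fun x => c + ∫ t in (0 : ℝ)..x, w t :=
  continuous_const.add (intervalIntegral.continuous_primitive
    (fun _ _ => hw.intervalIntegrable) 0)

theorem abs_primitive_add_le (hw : Integrable w) (c x : ℝ) :
    |c + ∫ t in (0 : ℝ)..x, w t| ≤ |c| + ∫ t, |w t| := by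
  refine (abs_add_le _ _).trans (add_le_add_right ?_ _)
  refine (intervalIntegral.norm_integral_le_integral_norm_uIoc (f := w) (μ := volume)).trans ?_
  exact setIntegral_le_integral hw.norm (Eventually.of_forall fun _ => norm_nonneg _)

/-- Almost everywhere, `a` is differentiable at the value of a primitive or the integrand is
zero. -/
theorem ae_differentiableAt_primitive (ha : LipschitzWith La a) (hw : Integrable w) (c : ℝ) :
    ∀ᵐ x, w x ≠ 0 → DifferentiableAt ℝ a (c + ∫ t in (0 : ℝ)..x, w t) := by
  filter_upwards [LocallyIntegrable.ae_hasDerivAt_integral hw.locallyIntegrable,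
    ha.ae_differentiableAt_of_hasDerivAt_ne_zero (fun x => c + ∫ t in (0 : ℝ)..x, w t)]
    with x hx hx' h
  exact hx' (w x) ((hx 0).const_add c) h

/-- The first variation of the energy at `u`, in terms of a continuous representative `U` and a
weak derivative `w`. -/
noncomputable def firstVariation (a b U w φ : ℝ → ℝ) (x : ℝ) : ℝ :=
  2 * a (U x) * w x * deriv φ x + deriv a (U x) * w x ^ 2 * φ x + deriv b (U x) * φ x

theorem firstVariation_hasDerivAt (hT : 0 < T)
    (ha : LipschitzWith La a) (hb : LipschitzWith Lb b) (hb' : Differentiable ℝ b)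
    (huw : HasWeakDeriv T u w) (hw : Integrable w) (hw2 : MemLp w 2 (intervalMeasure T))
    (hc : u =ᵐ[volume.restrict (Ioo 0 T)] fun x => c + ∫ t in (0 : ℝ)..x, w t)
    {φ : ℝ → ℝ} (hφ : IsTestFunction T φ) :
    IntegrableOn (firstVariation a b (fun x => c + ∫ t in (0 : ℝ)..x, w t) w φ) (Ioo 0 T) ∧
      HasDerivAt (fun t => energyF T a b (fun x => u x + t * φ x))
        (∫ x in Ioo 0 T, firstVariation a b (fun x => c + ∫ t in (0 : ℝ)..x, w t) w φ x) 0 := by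
  have hfin : IsFiniteMeasure (intervalMeasure T) := by unfold intervalMeasure; infer_instance
  obtain ⟨M₁, -, hM₁⟩ := hφ.exists_bound
  obtain ⟨M₂, -, hM₂⟩ := hφ.deriv.exists_bound
  have key := hasDerivAt_integral_energy (μ := intervalMeasure T) (M := max M₁ M₂) ha hb hb'
    (continuous_primitive_add hw c) (abs_primitive_add_le hw c) hw2 hφ.continuous
    hφ.deriv.continuous (fun x => (hM₁ x).trans (le_max_left _ _))
    (fun x => (hM₂ x).trans (le_max_right _ _))
    (ae_restrict_of_ae (ae_differentiableAt_primitive ha hw c))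
  refine ⟨key.1, ?_⟩
  convert! key.2 using 1
  funext t
  have h1 : weakDeriv T (fun x => u x + t * φ x) =ᵐ[volume.restrict (Ioo 0 T)]
      fun x => w x + t * deriv φ x :=
    (huw.add ((hφ.hasWeakDeriv hT).const_mul t)).weakDeriv_ae_eq
  refine integral_congr_ae ?_
  filter_upwards [h1, hc] with x hx1 hx2
  rw [hx1, hx2]

theorem firstVariation_nonneg (hT : 0 < T)
    (ha : LipschitzWith La a) (hb : LipschitzWith Lb b) (hb' : Differentiable ℝ b)
    (hu : IsSolutionA T a b u)
    (huw : HasWeakDeriv T u w) (hw : Integrable w) (hw2 : MemLp w 2 (intervalMeasure T))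
    (hc : u =ᵐ[volume.restrict (Ioo 0 T)] fun x => c + ∫ t in (0 : ℝ)..x, w t)
    {φ : ℝ → ℝ} (hφ : IsTestFunction T φ)
    (h : ∀ x ∈ Icc 0 (T - 1), 0 ≤ opB (fun x => c + ∫ t in (0 : ℝ)..x, w t) x + opB φ x) :
    0 ≤ ∫ x in Ioo 0 T, firstVariation a b (fun x => c + ∫ t in (0 : ℝ)..x, w t) w φ x := by
  refine nonneg_of_hasDerivAt_of_le
    (firstVariation_hasDerivAt hT ha hb hb' huw hw hw2 hc hφ).2 fun t ht => ?_
  simp only [zero_mul, add_zero]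
  refine hu.2 _ ⟨spaceU.add_test hT hu.1.1 (hφ.smul t), fun x hx => ?_⟩
  have h1 : (fun x => u x + t * φ x) =ᵐ[volume.restrict (Ioo 0 T)]
      fun x => (c + ∫ t in (0 : ℝ)..x, w t) + t * φ x := 
    hc.mono fun x hx => congrArg (· + t * φ x) hx
  have h2 := hu.1.2 x hx
  rw [opB_congr_ae hc hx] at h2
  -- With `U` the representative, `B(U + tφ) = (1-t) BU + t (BU + Bφ)` is a convex combination of
  -- nonnegative terms.
  rw [opB_congr_ae h1 hx, opB_add_mul (continuous_primitive_add hw c) hφ.continuous]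
  have h3 := mul_nonneg ht.1.le (h x hx)
  have h4 := mul_nonneg (sub_nonneg.2 ht.2) h2
  linarith

/-- The Lagrange multiplier, together with the weak form of the Euler–Lagrange equation. -/
theorem exists_multiplier_weak_equation (hT : 0 < T)
    (ha : LipschitzWith La a) (hb : LipschitzWith Lb b) (hb' : Differentiable ℝ b)
    (hu : IsSolutionA T a b u)
    (huw : HasWeakDeriv T u w) (hw : Integrable w) (hw2 : MemLp w 2 (intervalMeasure T))
    (hc : u =ᵐ[volume.restrict (Ioo 0 T)] fun x => c + ∫ t in (0 : ℝ)..x, w t) :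
    ∃ f : Measure ℝ, IsFiniteMeasure f ∧ f (Icc 0 (T - 1))ᶜ = 0 ∧ f.support ⊆ contactSet T u ∧
      ∀ φ, IsTestFunction T φ →
        ∫ x in Ioo 0 T, firstVariation a b (fun x => c + ∫ t in (0 : ℝ)..x, w t) w φ x
          = ∫ x in Ioo 0 T, f.real (Icc (x - 1) x) * φ x := by
  set U : ℝ → ℝ := fun x => c + ∫ t in (0 : ℝ)..x, w t with hUdef
  have hU : Continuous U := continuous_primitive_add hw c
  have hint : ∀ {φ}, IsTestFunction T φ → IntegrableOn (firstVariation a b U w φ) (Ioo 0 T) :=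
    fun hφ => (firstVariation_hasDerivAt hT ha hb hb' huw hw hw2 hc hφ).1
  let L : testSpace T →ₗ[ℝ] ℝ :=
    { toFun := fun φ => ∫ x in Ioo 0 T, firstVariation a b U w φ.1 x
      map_add' := fun φ ψ => by
        rw [← integral_add (hint φ.2) (hint ψ.2)]
        congr 1
        funext x
        have : deriv (φ.1 + ψ.1) x = deriv φ.1 x + deriv ψ.1 x :=
          deriv_add (IsTestFunction.differentiable φ.2 x) (IsTestFunction.differentiable ψ.2 x)
        simp only [firstVariation, Submodule.coe_add, this, Pi.add_apply]
        ring
      map_smul' := fun r φ => by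
        rw [RingHom.id_apply, smul_eq_mul, ← integral_const_mul]
        congr 1
        funext x
        have : deriv (r • φ.1) x = r * deriv φ.1 x :=
          deriv_const_smul r (IsTestFunction.differentiable φ.2 x)
        simp only [firstVariation, Submodule.coe_smul, this, Pi.smul_apply, smul_eq_mul]
        ring }
  let β : C(Icc (0 : ℝ) (T - 1), ℝ) :=
    ⟨fun x => opB U x, (continuous_opB hU).comp continuous_subtype_val⟩
  have hβ : 0 ≤ β := by
    rw [ContinuousMap.le_def]
    rintro ⟨x, hx⟩
    have h2 := hu.1.2 x hx
    rw [opB_congr_ae hc hx] at h2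
    exact h2
  obtain ⟨μ, hμ, hμB, hμβ⟩ := exists_multiplier_measure (opBTest T) L β hβ
    (fun φ hφ => firstVariation_nonneg hT ha hb hb' hu huw hw hw2 hc φ.2
      fun x hx => (ContinuousMap.le_def.1 hφ) ⟨x, hx⟩) (exists_test_opB_ge hT)
  have hemb : MeasurableEmbedding (Subtype.val : Icc (0 : ℝ) (T - 1) → ℝ) :=
    MeasurableEmbedding.subtype_coe measurableSet_Icc
  have hcompl : (μ.map Subtype.val) (Icc 0 (T - 1))ᶜ = 0 := by
    rw [hemb.map_apply]
    convert! measure_empty (μ := μ)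
    ext x
    simp
  have hcs : contactSet T u = Icc 0 (T - 1) ∩ {x | opB U x = 0} := by
    ext x
    refine and_congr_right fun hx => ?_
    rw [opB_congr_ae hc hx]
    rfl
  refine ⟨μ.map Subtype.val, inferInstance, hcompl, ?_, fun φ hφ => ?_⟩
  · refine Measure.support_subset_of_isClosed ?_ ?_
    · rw [hcs]
      exact isClosed_Icc.inter (isClosed_eq (continuous_opB hU) continuous_const)
    -- Complementary slackness: `β ≥ 0` has zero integral, so the closed contact set has full
    -- measure and contains the support.
    · have h1 : β =ᵐ[μ] 0 := (integral_eq_zero_iff_of_nonneg hβ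
        (β.continuous.integrable_of_hasCompactSupport (HasCompactSupport.of_compactSpace _))).1 hμβ
      have h2 : ∀ᵐ x ∂(μ.map Subtype.val), x ∈ contactSet T u := by
        rw [hcs, hemb.ae_map_iff]
        filter_upwards [h1] with x hx
        exact ⟨x.2, hx⟩
      exact h2
  · have h1 := hμB ⟨φ, hφ⟩
    have h2 : ∫ x, opB φ x ∂(μ.map Subtype.val) = ∫ x, opBTest T ⟨φ, hφ⟩ x ∂μ :=
      hemb.integral_map _
    rw [integral_opB _ (hφ.continuous.integrable_of_hasCompactSupport hφ.2.1), h1] at h2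
    rw [setIntegral_eq_integral_of_forall_compl_eq_zero
      (f := fun x => (μ.map Subtype.val).real (Icc (x - 1) x) * φ x), h2]
    · rfl
    · intro x hx
      rw [hφ.eq_zero hx, mul_zero]

end FirstOrder

/-! ### Regularity and the pointwise equation -/

theorem lipschitzWith_primitive_add {w : ℝ → ℝ} (hw : Integrable w) (c : ℝ) {R : ℝ≥0}
    (h : ∀ᵐ x, |w x| ≤ R) : LipschitzWith R fun x => c + ∫ t in (0 : ℝ)..x, w t := by
  refine LipschitzWith.of_dist_le_mul fun x y => ?_
  rw [Real.dist_eq, add_sub_add_left_eq_sub, intervalIntegral.integral_interval_sub_left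
    hw.intervalIntegrable hw.intervalIntegrable]
  exact intervalIntegral.norm_integral_le_of_norm_le_const_ae (f := w) (C := R)
    (h.mono fun t ht _ => ht)

theorem lipschitzWith_div {g q : ℝ → ℝ} {Lg Lq : ℝ≥0} (hg : LipschitzWith Lg g)
    (hq : LipschitzWith Lq q) {C q₀ : ℝ} (hC : ∀ x, |g x| ≤ C) (h0 : 0 < q₀)
    (hq0 : ∀ x, q₀ ≤ q x) : ∃ K, LipschitzWith K fun x => g x / q x := by
  have hC0 : 0 ≤ C := (abs_nonneg _).trans (hC 0)
  refine ⟨Real.toNNReal (Lg / q₀ + C * Lq / q₀ ^ 2), LipschitzWith.of_dist_le' fun x y => ?_⟩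
  have hx := h0.trans_le (hq0 x)
  have hy := h0.trans_le (hq0 y)
  have h1 : |g x - g y| ≤ Lg * |x - y| := hg.dist_le_mul x y
  have h2 : |q y - q x| ≤ Lq * |x - y| := by rw [abs_sub_comm]; exact hq.dist_le_mul x y
  have e : g x / q x - g y / q y = (g x - g y) / q x + g y * (q y - q x) / (q x * q y) := by
    field_simp
    ring
  rw [Real.dist_eq, Real.dist_eq, e]
  refine (abs_add_le _ _).trans ?_
  rw [add_mul, abs_div, abs_div, abs_mul, abs_mul, abs_of_pos hx, abs_of_pos hy]
  refine add_le_add ?_ ?_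
  · calc |g x - g y| / q x ≤ (Lg * |x - y|) / q₀ := by gcongr; exact hq0 x
      _ = _ := by ring
  · calc |g y| * |q y - q x| / (q x * q y) ≤ C * (Lq * |x - y|) / (q₀ * q₀) := by
          gcongr
          · exact hC y
          · exact hq0 x
          · exact hq0 y
      _ = _ := by ring

/-- Chain rule for a Lipschitz outer function, which is differentiable at the point unless the
inner derivative vanishes. -/
theorem LipschitzWith.hasDerivAt_comp {a U : ℝ → ℝ} {La : ℝ≥0} (ha : LipschitzWith La a)
    {x d : ℝ} (hU : HasDerivAt U d x) (h : d ≠ 0 → DifferentiableAt ℝ a (U x)) :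
    HasDerivAt (fun y => a (U y)) (deriv a (U x) * d) x := by
  by_cases hd : d = 0
  -- The increment of `a ∘ U` is at most `La` times that of `U`, which is `o(y - x)`.
  · subst hd
    rw [hasDerivAt_iff_isLittleO] at hU ⊢
    simp only [mul_zero, smul_zero, sub_zero] at hU ⊢
    exact (Asymptotics.IsBigO.of_bound La (Eventually.of_forall fun y =>
      ha.dist_le_mul _ _)).trans_isLittleO hU
  · exact (h hd).hasDerivAt.comp x hU

section Regularity

variable {T : ℝ} {a b : ℝ → ℝ} {a₀ : ℝ} {La Lb : ℝ≥0} {u w U m : ℝ → ℝ}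

/-- The right-hand side `(2a(u)u')'` of the Euler–Lagrange equation in divergence form. -/
noncomputable def fluxDeriv (a b U w m : ℝ → ℝ) (x : ℝ) : ℝ :=
  deriv a (U x) * w x ^ 2 + deriv b (U x) - m x

theorem abs_deriv_le_of_lipschitzWith {g : ℝ → ℝ} {L : ℝ≥0} (hg : LipschitzWith L g) (y : ℝ) :
    |deriv g y| ≤ L := norm_deriv_le_of_lipschitz hg

theorem integrableOn_fluxDeriv (ha : LipschitzWith La a) (hb : LipschitzWith Lb b)
    (hU : Continuous U) (hw2 : MemLp w 2 (intervalMeasure T)) (hm : Measurable m) {Cm : ℝ}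
    (hmC : ∀ x, |m x| ≤ Cm) : IntegrableOn (fluxDeriv a b U w m) (Ioo 0 T) := by
  have hfin : IsFiniteMeasure (intervalMeasure T) := by unfold intervalMeasure; infer_instance
  refine Integrable.sub (Integrable.add ?_ ?_) ?_
  · exact hw2.integrable_sq.bdd_mul (c := La)
      ((measurable_deriv a).comp hU.measurable).aestronglyMeasurable
      (Eventually.of_forall fun x => abs_deriv_le_of_lipschitzWith ha _)
  · exact Integrable.of_bound (μ := intervalMeasure T)
      ((measurable_deriv b).comp hU.measurable).aestronglyMeasurable Lb
      (Eventually.of_forall fun x => abs_deriv_le_of_lipschitzWith hb _)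
  · exact Integrable.of_bound (μ := intervalMeasure T) hm.aestronglyMeasurable Cm
      (Eventually.of_forall hmC)

theorem hasWeakDeriv_flux (ha : LipschitzWith La a) (hb : LipschitzWith Lb b)
    (hU : Continuous U) {C : ℝ} (hUC : ∀ x, |U x| ≤ C) (hw2 : MemLp w 2 (intervalMeasure T))
    (hm : Measurable m) {Cm : ℝ} (hmC : ∀ x, |m x| ≤ Cm)
    (heq : ∀ φ, IsTestFunction T φ →
      ∫ x in Ioo 0 T, firstVariation a b U w φ x = ∫ x in Ioo 0 T, m x * φ x) :
    HasWeakDeriv T (fun x => 2 * a (U x) * w x) (fluxDeriv a b U w m) := by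
  have hfin : IsFiniteMeasure (intervalMeasure T) := by unfold intervalMeasure; infer_instance
  have hi := (integrableOn_fluxDeriv ha hb hU hw2 hm hmC).locallyIntegrableOn
  have hi2 : IntegrableOn (fun x => 2 * a (U x) * w x) (Ioo 0 T) := by
    refine (hw2.integrable one_le_two).bdd_mul (c := 2 * (|a 0| + La * C))
      (continuous_const.mul (ha.continuous.comp hU)).aestronglyMeasurable
      (Eventually.of_forall fun x => ?_)
    rw [Real.norm_eq_abs, abs_mul, abs_two]
    exact mul_le_mul_of_nonneg_left (ha.abs_comp_le (hUC x)) zero_le_two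
  have hmi : LocallyIntegrableOn m (Ioo 0 T) := IntegrableOn.locallyIntegrableOn
    (Integrable.of_bound (μ := intervalMeasure T) hm.aestronglyMeasurable Cm
      (Eventually.of_forall hmC))
  refine ⟨hi2.locallyIntegrableOn, hi, fun φ hφ => ?_⟩
  have h1 := hφ.deriv.integrable_mul hi2.locallyIntegrableOn
  have h2 := hφ.integrable_mul hi
  have h3 := hφ.integrable_mul hmi
  have h23 : IntegrableOn (fun x => fluxDeriv a b U w m x * φ x + m x * φ x) (Ioo 0 T) :=
    h2.add h3
  have e : ∀ x, firstVariation a b U w φ x = 2 * a (U x) * w x * deriv φ x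
      + (fluxDeriv a b U w m x * φ x + m x * φ x) := fun x => by
    simp only [firstVariation, fluxDeriv]; ring
  have h4 := heq φ hφ
  simp only [e] at h4
  rw [integral_add h1 h23, integral_add h2 h3] at h4
  simp only
  linarith

/-- A weak solution of the Euler–Lagrange equation lies in `W^{2,∞}` and solves the equation
almost everywhere. -/
theorem regularity_of_weak_equation (hT : 0 < T) (ha : LipschitzWith La a)
    (hb : LipschitzWith Lb b) (ha₀ : 0 < a₀) (haa₀ : ∀ y, a₀ ≤ a y) {c : ℝ}
    (huw : HasWeakDeriv T u w) (hw : Integrable w) (hw2 : MemLp w 2 (intervalMeasure T))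
    (hw0 : ∀ x ∉ Ioo 0 T, w x = 0)
    (hc : u =ᵐ[volume.restrict (Ioo 0 T)] fun x => c + ∫ t in (0 : ℝ)..x, w t)
    (hm : Measurable m) {Cm : ℝ≥0} (hmC : ∀ x, |m x| ≤ Cm)
    (heq : ∀ φ, IsTestFunction T φ →
      ∫ x in Ioo 0 T, firstVariation a b (fun x => c + ∫ t in (0 : ℝ)..x, w t) w φ x
        = ∫ x in Ioo 0 T, m x * φ x) :
    MemSobolev T ∞ 2 u ∧ ∀ᵐ x ∂(volume.restrict (Ioo 0 T)),
      -2 * a (u x) * weakDeriv T (weakDeriv T u) x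
        - deriv a (u x) * (weakDeriv T u x) ^ 2 + deriv b (u x) = m x := by
  have hfin : IsFiniteMeasure (intervalMeasure T) := by unfold intervalMeasure; infer_instance
  have hdiff := ae_differentiableAt_primitive ha hw c
  have hUd := LocallyIntegrable.ae_hasDerivAt_integral hw.locallyIntegrable
  have hUc := continuous_primitive_add hw c
  have hUb := abs_primitive_add_le hw c
  set U : ℝ → ℝ := fun x => c + ∫ t in (0 : ℝ)..x, w t with hUdef
  set h : ℝ → ℝ := (Ioo 0 T).indicator (fluxDeriv a b U w m) with hh
  have hhi : Integrable h := (integrable_indicator_iff measurableSet_Ioo).2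
    (integrableOn_fluxDeriv ha hb hUc hw2 hm hmC)
  have hflux : HasWeakDeriv T (fun x => 2 * a (U x) * w x) h :=
    (hasWeakDeriv_flux ha hb hUc hUb hw2 hm hmC heq).congr_ae (ae_eq_refl _)
      (indicator_ae_eq_restrict measurableSet_Ioo).symm
  obtain ⟨c', hc'⟩ := hflux.ae_eq_primitive hT hhi
  have hΓb := abs_primitive_add_le hhi c'
  set Γ : ℝ → ℝ := fun x => c' + ∫ t in (0 : ℝ)..x, h t with hΓdef
  set C : ℝ := |c'| + ∫ t, |h t| with hCdef
  have hC0 : 0 ≤ C := (abs_nonneg _).trans (hΓb 0)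
  have hapos : ∀ y, 0 < a y := fun y => ha₀.trans_le (haa₀ y)
  set V : ℝ → ℝ := fun x => Γ x / (2 * a (U x)) with hV
  have hwV : w =ᵐ[volume.restrict (Ioo 0 T)] V := by
    filter_upwards [hc'] with x hx
    rw [hV, eq_div_iff (by have := hapos (U x); positivity), mul_comm]
    exact hx
  -- First gain: integrability of `h` already bounds the flux by `C`, and ellipticity then bounds
  -- `w`.
  let R : ℝ≥0 := ⟨C / (2 * a₀), by positivity⟩
  have hVR : ∀ x, |V x| ≤ R := fun x => by
    have h1 := hapos (U x)
    have h2 := haa₀ (U x)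
    change |Γ x / (2 * a (U x))| ≤ C / (2 * a₀)
    rw [abs_div, abs_of_pos (by positivity : 0 < 2 * a (U x))]
    gcongr
    exact hΓb x
  have hwR : ∀ᵐ x, |w x| ≤ R := by
    filter_upwards [(ae_restrict_iff' measurableSet_Ioo).1 hwV] with x hx
    by_cases hxT : x ∈ Ioo 0 T
    · rw [hx hxT]; exact hVR x
    · rw [hw0 x hxT, abs_zero]; exact R.2
  have hUL : LipschitzWith R U := lipschitzWith_primitive_add hw c hwR
  -- Second gain: with `w` bounded, the quadratic term of `h` is bounded too, so the flux is
  -- Lipschitz.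
  have hhR : ∀ᵐ x, |h x| ≤ (La * R ^ 2 + Lb + Cm : ℝ≥0) := by
    filter_upwards [hwR] with x hx
    by_cases hxT : x ∈ Ioo 0 T
    · rw [hh, indicator_of_mem hxT]
      push_cast
      refine (abs_sub _ _).trans (add_le_add ((abs_add_le _ _).trans (add_le_add ?_ ?_)) (hmC x))
      · rw [abs_mul, abs_pow]
        gcongr
        exact abs_deriv_le_of_lipschitzWith ha _
      · exact abs_deriv_le_of_lipschitzWith hb _
    · rw [hh, indicator_of_notMem hxT, abs_zero]; positivity
  have hΓL := lipschitzWith_primitive_add hhi c' hhR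
  have h2a : LipschitzWith (2 * (La * R)) fun x => 2 * a (U x) := by
    refine LipschitzWith.of_dist_le_mul fun x y => ?_
    have := (ha.comp hUL).dist_le_mul x y
    simp only [Function.comp_apply, Real.dist_eq] at this
    rw [Real.dist_eq, ← mul_sub, abs_mul, abs_two]
    push_cast at this ⊢
    rw [mul_assoc]
    exact mul_le_mul_of_nonneg_left this zero_le_two
  obtain ⟨K, hK⟩ : ∃ K, LipschitzWith K V := lipschitzWith_div hΓL h2a hΓb
    (by positivity : 0 < 2 * a₀) fun x => mul_le_mul_of_nonneg_left (haa₀ _) zero_le_two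
  have hVV' : HasWeakDeriv T V (deriv V) := hK.hasWeakDeriv hT
  have huV : HasWeakDeriv T u V := huw.congr_ae (ae_eq_refl _) hwV
  have hu1 := huV.weakDeriv_ae_eq
  have hu2 : weakDeriv T (weakDeriv T u) =ᵐ[volume.restrict (Ioo 0 T)] deriv V :=
    (hVV'.congr_ae hu1.symm (ae_eq_refl _)).weakDeriv_ae_eq
  refine ⟨⟨?_, V, huV, ?_, deriv V, hVV', ?_⟩, ?_⟩
  · refine MemLp.ae_eq (hc.symm : U =ᵐ[intervalMeasure T] u) ?_
    exact memLp_top_of_bound hUc.aestronglyMeasurable _ (Eventually.of_forall hUb)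
  · exact memLp_top_of_bound hK.continuous.aestronglyMeasurable R (Eventually.of_forall hVR)
  · exact memLp_top_of_bound (measurable_deriv V).aestronglyMeasurable K
      (Eventually.of_forall fun x => abs_deriv_le_of_lipschitzWith hK x)
  · filter_upwards [hc, hu1, hu2, hwV, ae_restrict_of_ae hdiff, ae_restrict_of_ae hUd,
      ae_restrict_of_ae (LocallyIntegrable.ae_hasDerivAt_integral hhi.locallyIntegrable),
      ae_restrict_of_ae hK.ae_differentiableAt_real, ae_restrict_mem measurableSet_Ioo]
      with x hx0 hx1 hx2 hxw hxa hxU hxΓ hxV hxT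
    have d1 : HasDerivAt U (w x) x := (hxU 0).const_add c
    have d2 : HasDerivAt Γ (h x) x := (hxΓ 0).const_add c'
    -- The flux is also the product `2a(U) V`; comparing the product rule with `Γ' = h` yields the
    -- equation, with `V' = u''`.
    have d3 := ((ha.hasDerivAt_comp d1 hxa).const_mul 2).mul hxV.hasDerivAt
    have e : Γ = (fun y => 2 * a (U y)) * V := by
      funext y
      have := (hapos (U y)).ne'
      simp only [hV, Pi.mul_apply]
      field_simp
    rw [e] at d2
    have key := d2.unique d3
    rw [hh, indicator_of_mem hxT, fluxDeriv, ← hxw] at key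
    have hx0 : u x = U x := hx0
    rw [hx2, hx1, hx0, ← hxw]
    linarith

end Regularity

end

/-- The measure `f` lives on `[0,T-1]` and is extended by zero to `ℝ`; the choice of a closed
interval in `f [x-1,x]` is immaterial, since `f` has at most countably many atoms. -/
theorem mainTheorem3 (T : ℝ) (hT : 0 < T) (a b : ℝ → ℝ) (a₀ : ℝ) (La Lb : ℝ≥0)
    (ha : LipschitzWith La a) (hb : LipschitzWith Lb b) (hb' : Differentiable ℝ b)
    (ha₀ : 0 < a₀) (haa₀ : ∀ y, a₀ ≤ a y)
    (u : ℝ → ℝ) (hu : IsSolutionA T a b u) :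
    MemSobolev T ∞ 2 u ∧
      ∃ f : Measure ℝ, IsFiniteMeasure f ∧ f (Set.Icc 0 (T - 1))ᶜ = 0 ∧
        f.support ⊆ contactSet T u ∧
        ∀ᵐ x ∂(volume.restrict (Set.Ioo 0 T)),
          -2 * a (u x) * weakDeriv T (weakDeriv T u) x
              - deriv a (u x) * (weakDeriv T u x) ^ 2 + deriv b (u x)
            = f.real (Set.Icc (x - 1) x) := by
  obtain ⟨w, c, huw, hw, hw2, hw0, hc⟩ := spaceU.exists_representative hT hu.1.1
  obtain ⟨f, hf, hf0, hfs, heq⟩ :=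
    exists_multiplier_weak_equation hT ha hb hb' hu huw hw hw2 hc
  have hreg := regularity_of_weak_equation (m := fun x => f.real (Set.Icc (x - 1) x))
    (Cm := ⟨f.real Set.univ, measureReal_nonneg⟩) hT ha hb ha₀ haa₀ huw hw hw2 hw0 hc
    (measurable_measureReal_window f)
    (fun x => (abs_of_nonneg measureReal_nonneg).trans_le
      (measureReal_mono (Set.subset_univ _))) heq
  exact ⟨hreg.1, f, hf, hf0, hfs, hreg.2⟩
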